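/- Let $\mu\in\mathbb R$, $\sigma>0$, $\gamma=\mu+i\sigma$, and let $X_1,X_2,\dots$ be independent real random variables on a probability space, each with the Cauchy distribution $C(\mu,\sigma)$ with location $\mu$ and scale $\sigma$, i.e. with density $\frac{\sigma}{\pi}\frac{1}{(x-\mu)^2+\sigma^2}$. Fix $k\in\mathbb Z$ and let $\log z=\log|z|+(\arg z+2k\pi)i$, $0\le\arg z<2\pi$, for $z\in\mathbb C\setminus\{0\}$; powers are $z^p=\exp(p\log z)$. For $N\ge 2$ put $$P_N=\prod_{j=1}^N X_j^{1/N},\qquad V_N=\frac1{N-1}\sum_{j=1}^N|\log X_j|^2-\left|\frac1N\sum_{j=1}^N\log X_j\right|^2,$$ which are almost surely defined. For $p\in\mathbb C$ and $r\ge 0$ let $Q(p,r)=\{z\in\mathbb C:\ |\mathrm{Re}(z-p)|\le r,\ |\mathrm{Im}(z-p)|\le r\}$ be the closed square with centre $p$ and side length $2r$. For $0<a<1$ let $\rho_a\in\mathbb R$ be the upper $a$-quantile of the standard normal distribution, that is, $\int_{-\infty}^{\rho_a}\frac1{\sqrt{2\pi}}e^{-x^2/2}\,dx=1-a$. Then,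 for every $0<\alpha\le1$, with $\beta=\frac12\bigl(1-\sqrt{1-\alpha}\bigr)$, $$\lim_{N\to\infty}P\left(\gamma\in Q\left(P_N,\frac{\sqrt{V_N}}{\sqrt{2N}}\,|P_N|\,\rho_\beta\right)\right)=1-\alpha .$$ -/

import Mathlib

open MeasureTheory ProbabilityTheory Filter Topology

noncomputable section

namespace CauchyGM

/-- The argument of a complex number taken in `[0, 2π)` (with the convention `arg 0 = 0`). -/
def argNonneg (z : ℂ) : ℝ :=
  if 0 ≤ Complex.arg z then Complex.arg z else Complex.arg z + 2 * Real.pi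

/-- The `k`-th branch of the complex logarithm,
`log z = log |z| + (arg z + 2 k π) i` with `0 ≤ arg z < 2π`. -/
def branchLog (k : ℤ) (z : ℂ) : ℂ :=
  (Real.log ‖z‖ : ℂ) + ((argNonneg z + 2 * (k : ℝ) * Real.pi : ℝ) : ℂ) * Complex.I

/-- The real power `z ^ p = exp (p log z)` formed with the `k`-th branch of the logarithm. -/
def branchPow (k : ℤ) (z : ℂ) (p : ℝ) : ℂ :=
  Complex.exp ((p : ℂ) * branchLog k z)

/-- The geometric mean `P_N = ∏_{j=1}^N x_j ^ (1/N)` of the first `N` terms of a real sequence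
(the terms `x 0, …, x (N - 1)`). -/
def geomMean (k : ℤ) (N : ℕ) (x : ℕ → ℝ) : ℂ :=
  ∏ j ∈ Finset.range N, branchPow k (x j : ℂ) (1 / (N : ℝ))

/-- The variance estimator
`V_N = (N - 1)⁻¹ ∑_{j=1}^N |log x_j|² - |N⁻¹ ∑_{j=1}^N log x_j|²`. -/
def logVar (k : ℤ) (N : ℕ) (x : ℕ → ℝ) : ℝ :=
  1 / ((N : ℝ) - 1) * ∑ j ∈ Finset.range N, ‖branchLog k (x j : ℂ)‖ ^ 2
    - ‖1 / (N : ℂ) * ∑ j ∈ Finset.range N, branchLog k (x j : ℂ)‖ ^ 2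

/-- The closed square in the complex plane with centre `p` and side length `2 r`. -/
def square (p : ℂ) (r : ℝ) : Set ℂ :=
  {z : ℂ | z.re ∈ Set.Icc (p.re - r) (p.re + r) ∧ z.im ∈ Set.Icc (p.im - r) (p.im + r)}

/-- `ρ` is the upper `a`-quantile of the standard real normal distribution. -/
def IsUpperNormalQuantile (a ρ : ℝ) : Prop :=
  ∫ x in Set.Iic ρ, 1 / Real.sqrt (2 * Real.pi) * Real.exp (-x ^ 2 / 2) = 1 - a

end CauchyGM

end

/-! The Cauchy law is harmonic measure of the upper half plane seen from `γ`. Writing `x = μ + σ tan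
φ` makes `φ` uniform, and `x` is the boundary value at `e^{2iφ}` of a Möbius map of the disc onto
the half plane with `0 ↦ γ`. The mean value property for `log` and `log ^ 2` composed with this map
gives `E[log X] = log γ` and `E[(log X)^2] = (log γ)^2` (`setIntegral_log_pow`).

Hence `Z = log X - log γ` satisfies `E Z = 0` and `E Z^2 = 0`: its real and imaginary parts are
uncorrelated with equal variance. The central limit theorem then has an isotropic Gaussian limit
(`tendstoInDistribution_inv_sqrt_smul_sum_complex`), insensitive to rotation by `γ / |γ|`. As `P_N =
γ exp(mean of Z)`, the delta method and Slutsky's theorem, with `V_N → E|Z|^2`, show that the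
studentised error is asymptotically standard Gaussian on the plane
(`tendstoInDistribution_studentized`). The square has Gaussian mass `(1 - 2β)^2 = 1 - α`. -/

namespace CauchyGM
-- Integrable singularities, and the tangent substitution for the Cauchy law
open Real Set intervalIntegral

/-- A quarter-power bound for the square of the logarithm. -/
lemma sq_log_le {y : ℝ} (hy : 0 < y) :
    Real.log y ^ 2 ≤ 16 * (y ^ (1 / 2 : ℝ) + y ^ (-(1 / 2) : ℝ)) := by
  have key : ∀ z : ℝ, 1 ≤ z → Real.log z ^ 2 ≤ 16 * z ^ (1 / 2 : ℝ) := by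
    intro z hz
    have h0 := Real.log_nonneg hz
    have h1 := Real.log_le_rpow_div (x := z) (ε := 1 / 4) (by linarith) (by norm_num)
    calc Real.log z ^ 2 ≤ (z ^ (1 / 4 : ℝ) / (1 / 4)) ^ 2 := by gcongr
      _ = 16 * (z ^ (1 / 4 : ℝ)) ^ 2 := by ring
      _ = 16 * z ^ (1 / 2 : ℝ) := by
        rw [← Real.rpow_natCast, ← Real.rpow_mul (by linarith)]; norm_num
  have p1 := Real.rpow_nonneg hy.le (1 / 2)
  have p2 := Real.rpow_nonneg hy.le (-(1 / 2))
  rcases le_total 1 y with h | h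
  · linarith [key y h]
  · have := key y⁻¹ ((one_le_inv₀ hy).2 h)
    rw [Real.log_inv, Real.inv_rpow hy.le, ← Real.rpow_neg hy.le] at this
    linarith [neg_sq (Real.log y)]

/-- Jordan's inequality `sin x ≥ 2x/π` compares with `x ^ (-1/2)` on `(0, π/2]`; reflection in `π/2`
and periodicity do the rest. -/
lemma intervalIntegrable_abs_sin_rpow (a b : ℝ) :
    IntervalIntegrable (fun x => |Real.sin x| ^ (-(1 / 2) : ℝ)) volume a b := by
  have hper : Function.Periodic (fun x => |Real.sin x| ^ (-(1 / 2) : ℝ)) π := by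
    intro x; simp [Real.sin_add_pi]
  have half : IntervalIntegrable (fun x => |Real.sin x| ^ (-(1 / 2) : ℝ)) volume 0 (π / 2) := by
    have hg : IntervalIntegrable (fun x : ℝ => (2 / π) ^ (-(1 / 2) : ℝ) * x ^ (-(1 / 2) : ℝ))
        volume 0 (π / 2) :=
      (intervalIntegrable_rpow' (by norm_num)).const_mul _
    refine hg.mono_fun (Measurable.aestronglyMeasurable (by fun_prop)) ?_
    rw [uIoc_of_le (by positivity)]
    refine (ae_restrict_iff' measurableSet_Ioc).2 (ae_of_all _ fun x hx => ?_)
    have h1 := Real.mul_le_sin hx.1.le hx.2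
    have h2 : 0 < 2 / π * x := mul_pos (by positivity) hx.1
    simp only
    rw [Real.norm_of_nonneg (by positivity), ← Real.mul_rpow (by positivity) hx.1.le,
      Real.norm_of_nonneg (Real.rpow_nonneg h2.le _), abs_of_pos (h2.trans_le h1)]
    exact Real.rpow_le_rpow_of_nonpos h2 h1 (by norm_num)
  have half' : IntervalIntegrable (fun x => |Real.sin x| ^ (-(1 / 2) : ℝ)) volume (π / 2) π := by
    have := (half.comp_sub_left π).symm
    simp only [Real.sin_pi_sub, sub_zero] at this
    rwa [show π - π / 2 = π / 2 by ring] at this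
  exact hper.intervalIntegrable₀ Real.pi_pos.ne' (half.trans half') a b

lemma intervalIntegrable_abs_cos_sub_rpow (c a b : ℝ) :
    IntervalIntegrable (fun x => |Real.cos (x - c)| ^ (-(1 / 2) : ℝ)) volume a b := by
  have := (intervalIntegrable_abs_sin_rpow (a - c + π / 2) (b - c + π / 2)).comp_add_right
    (π / 2 - c)
  have e : ∀ x : ℝ, Real.sin (x + (π / 2 - c)) = Real.cos (x - c) := fun x => by
    rw [← Real.sin_add_pi_div_two]; ring_nf
  simp only [e] at this
  convert this using 1 <;> ring

lemma hasDerivAt_add_mul_tan (μ σ : ℝ) {φ : ℝ} (hφ : φ ∈ Ioo (-(π / 2)) (π / 2)) :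
    HasDerivAt (fun φ => μ + σ * Real.tan φ) (σ * (1 / Real.cos φ ^ 2)) φ :=
  ((Real.hasDerivAt_tan (Real.cos_pos_of_mem_Ioo hφ).ne').const_mul σ).const_add μ

variable {μ : ℝ} {σ : NNReal}

lemma image_add_mul_tan (hσ : 0 < σ) :
    (fun φ => μ + σ * Real.tan φ) '' Ioo (-(π / 2)) (π / 2) = univ := by
  refine eq_univ_of_forall fun y => ⟨Real.arctan ((y - μ) / σ), Real.arctan_mem_Ioo _, ?_⟩
  simp only [Real.tan_arctan]
  field_simp
  ring

lemma injOn_add_mul_tan (hσ : 0 < σ) :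
    InjOn (fun φ => μ + σ * Real.tan φ) (Ioo (-(π / 2)) (π / 2)) := by
  intro x hx y hy h
  have : Real.tan x = Real.tan y := by
    have h' : (σ : ℝ) * Real.tan x = σ * Real.tan y := by simpa using h
    exact mul_left_cancel₀ (NNReal.coe_ne_zero.2 hσ.ne') h'
  exact Real.injOn_tan hx hy this

/-- The Jacobian cancels the density, so the angle is uniform on an interval of length `π`. -/
lemma abs_deriv_mul_cauchyPDFReal (hσ : 0 < σ) {φ : ℝ} (hφ : φ ∈ Ioo (-(π / 2)) (π / 2)) :
    |σ * (1 / Real.cos φ ^ 2)| * cauchyPDFReal μ σ (μ + σ * Real.tan φ) = π⁻¹ := by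
  have hc := Real.cos_pos_of_mem_Ioo hφ
  rw [abs_of_pos (by positivity), cauchyPDFReal_def, Real.tan_eq_sin_div_cos]
  have : (μ + σ * (Real.sin φ / Real.cos φ) - μ) ^ 2 + σ ^ 2 = σ ^ 2 / Real.cos φ ^ 2 := by
    field_simp
    have := Real.sin_sq_add_cos_sq φ
    ring_nf
    linear_combination σ^2 * this
  rw [this]
  field_simp

lemma cauchyMeasure_eq (hσ : 0 < σ) : cauchyMeasure μ σ =
    volume.withDensity (fun x => ((cauchyPDFReal μ σ x).toNNReal : ENNReal)) := by
  rw [cauchyMeasure_of_scale_ne_zero _ hσ.ne']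
  rfl

section
variable {E : Type*} [NormedAddCommGroup E] [NormedSpace ℝ E]

lemma integrable_cauchyMeasure_iff (hσ : 0 < σ) (g : ℝ → E) :
    Integrable g (cauchyMeasure μ σ) ↔
      IntegrableOn (fun φ => g (μ + σ * Real.tan φ)) (Ioo (-(π / 2)) (π / 2)) := by
  have hpos := cauchyPDF_pos μ hσ.ne'
  rw [cauchyMeasure_eq hσ, integrable_withDensity_iff_integrable_smul (by fun_prop),
    ← integrableOn_univ, ← image_add_mul_tan (μ := μ) hσ,
    integrableOn_image_iff_integrableOn_abs_deriv_smul measurableSet_Ioo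
      (fun φ hφ => (hasDerivAt_add_mul_tan μ σ hφ).hasDerivWithinAt) (injOn_add_mul_tan hσ)]
  rw [← integrableOn_congr_fun (f := fun φ => π⁻¹ • g (μ + σ * Real.tan φ)) ?_ measurableSet_Ioo]
  · exact integrable_smul_iff (c := π⁻¹) (by positivity) _
  · intro φ hφ
    simp only [NNReal.smul_def, Real.coe_toNNReal _ (hpos _).le, smul_smul]
    rw [abs_deriv_mul_cauchyPDFReal hσ hφ]

lemma integral_cauchyMeasure (hσ : 0 < σ) (g : ℝ → E) :
    ∫ x, g x ∂(cauchyMeasure μ σ) =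
      π⁻¹ • ∫ φ in Ioo (-(π / 2)) (π / 2), g (μ + σ * Real.tan φ) := by
  have hpos := cauchyPDF_pos μ hσ.ne'
  rw [cauchyMeasure_eq hσ, integral_withDensity_eq_integral_smul (by fun_prop),
    ← setIntegral_univ, ← image_add_mul_tan (μ := μ) hσ,
    integral_image_eq_integral_abs_deriv_smul measurableSet_Ioo
      (fun φ hφ => (hasDerivAt_add_mul_tan μ σ hφ).hasDerivWithinAt) (injOn_add_mul_tan hσ),
    ← MeasureTheory.integral_smul]
  refine setIntegral_congr_fun measurableSet_Ioo fun φ hφ => ?_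
  simp only [NNReal.smul_def, Real.coe_toNNReal _ (hpos _).le, smul_smul]
  rw [abs_deriv_mul_cauchyPDFReal hσ hφ]

end
end CauchyGM

/-! ### Moments of the logarithm from the mean value property -/

namespace CauchyGM
open Real Set intervalIntegral ComplexConjugate

/-- The Möbius map carrying the unit disc to the upper half plane and `0` to `γ`. -/
noncomputable def discToHalfPlane (γ w : ℂ) : ℂ := (γ + conj γ * w) / (1 + w)

variable {γ : ℂ}

lemma one_add_ne_zero_of_norm_lt {w : ℂ} (hw : ‖w‖ < 1) : 1 + w ≠ 0 := by
  intro h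
  rw [eq_neg_of_add_eq_zero_right h] at hw
  simp at hw

lemma discToHalfPlane_im (γ w : ℂ) :
    (discToHalfPlane γ w).im = γ.im * (1 - ‖w‖ ^ 2) / ‖1 + w‖ ^ 2 := by
  rw [discToHalfPlane, Complex.div_im, Complex.sq_norm, Complex.sq_norm, Complex.normSq_apply w]
  simp only [Complex.add_re, Complex.add_im, Complex.mul_re, Complex.mul_im, Complex.conj_re,
    Complex.conj_im, Complex.one_re, Complex.one_im]
  ring

lemma discToHalfPlane_im_pos (hγ : 0 < γ.im) {w : ℂ} (hw : ‖w‖ < 1) :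
    0 < (discToHalfPlane γ w).im := by
  rw [discToHalfPlane_im]
  have h1 : 0 < ‖1 + w‖ := norm_pos_iff.2 (one_add_ne_zero_of_norm_lt hw)
  have h2 : 0 < 1 - ‖w‖ ^ 2 := by nlinarith [norm_nonneg w]
  positivity

lemma differentiableOn_log_discToHalfPlane_pow (hγ : 0 < γ.im) (m : ℕ) :
    DifferentiableOn ℂ (fun w => Complex.log (discToHalfPlane γ w) ^ m) (Metric.ball 0 1) := by
  intro w hw
  have hw' : ‖w‖ < 1 := by simpa using hw
  have h1 : DifferentiableAt ℂ (discToHalfPlane γ) w := by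
    unfold discToHalfPlane
    exact DifferentiableAt.div (by fun_prop) (by fun_prop) (one_add_ne_zero_of_norm_lt hw')
  exact ((h1.clog (Or.inr (discToHalfPlane_im_pos hγ hw').ne')).pow m).differentiableWithinAt

/-- Factoring out `e^{iφ}` leaves `2 cos (φ - a)`. This locates the zeros of both numerator and
denominator of the Möbius map on the unit circle. -/
lemma norm_exp_add_exp_mul (a φ : ℝ) :
    ‖Complex.exp (a * Complex.I) + Complex.exp (-(a * Complex.I)) * Complex.exp (2 * φ * Complex.I)‖
      = 2 * |Real.cos (φ - a)| := by
  have : Complex.exp (a * Complex.I) + Complex.exp (-(a * Complex.I)) *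
      Complex.exp (2 * φ * Complex.I) =
      Complex.exp (φ * Complex.I) * (2 * Complex.cos ((φ - a : ℝ) : ℂ)) := by
    rw [Complex.two_cos, mul_add, ← Complex.exp_add, ← Complex.exp_add, ← Complex.exp_add, add_comm]
    push_cast
    congr 2 <;> ring
  rw [this, norm_mul, Complex.norm_exp_ofReal_mul_I, one_mul, norm_mul, ← Complex.ofReal_cos,
    Complex.norm_real]
  simp

lemma norm_add_conj_mul_exp (γ : ℂ) (φ : ℝ) :
    ‖γ + conj γ * Complex.exp (2 * φ * Complex.I)‖ =
      2 * (‖γ‖ * |Real.cos (φ - Complex.arg γ)|) := by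
  have h : γ + conj γ * Complex.exp (2 * φ * Complex.I) = ‖γ‖ * (Complex.exp (γ.arg * Complex.I) +
      Complex.exp (-(γ.arg * Complex.I)) * Complex.exp (2 * φ * Complex.I)) := by
    have h2 : conj γ = ‖γ‖ * Complex.exp (-(γ.arg * Complex.I)) := by
      conv_lhs => rw [← Complex.norm_mul_exp_arg_mul_I γ]
      rw [map_mul, Complex.conj_ofReal, ← Complex.exp_conj]
      simp
    conv_lhs => rw [h2]; lhs; rw [← Complex.norm_mul_exp_arg_mul_I γ]
    ring
  rw [h, norm_mul, norm_exp_add_exp_mul]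
  simp
  ring

lemma norm_one_add_exp (φ : ℝ) : ‖1 + Complex.exp (2 * φ * Complex.I)‖ = 2 * |Real.cos φ| := by
  simpa using norm_exp_add_exp_mul 0 φ

/-- Passing from radius `1` to radius `r` costs at most a factor `2`, since the defect `(1 - r)‖b‖ =
‖a‖ - ‖r b‖` is itself at most `‖a + r b‖`. This makes the bounds on circles uniform in `r`. -/
lemma norm_add_le_two_mul_norm_add_smul {a b : ℂ} (hab : ‖a‖ = ‖b‖) {r : ℝ} (hr0 : 0 ≤ r)
    (hr1 : r ≤ 1) : ‖a + b‖ ≤ 2 * ‖a + r * b‖ := by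
  have h1 : ‖a + b‖ ≤ ‖a + r * b‖ + (1 - r) * ‖b‖ := by
    have : a + b = (a + r * b) + ((1 - r : ℝ) : ℂ) * b := by push_cast; ring
    rw [this]
    refine (norm_add_le _ _).trans_eq ?_
    rw [norm_mul ((1 - r : ℝ) : ℂ), Complex.norm_real, Real.norm_of_nonneg (by linarith)]
  have h2 : ‖a‖ - ‖(r : ℂ) * b‖ ≤ ‖a + r * b‖ := by
    simpa using norm_sub_norm_le a (-((r : ℂ) * b))
  rw [norm_mul, Complex.norm_real, Real.norm_of_nonneg hr0] at h2
  nlinarith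

/-- For `u = e^{2iφ}` one has `(1 - u) / (1 + u) = -i tan φ`. -/
lemma discToHalfPlane_exp (γ : ℂ) {φ : ℝ} (hφ : Real.cos φ ≠ 0) :
    discToHalfPlane γ (Complex.exp (2 * φ * Complex.I)) =
      ((γ.re + γ.im * Real.tan φ : ℝ) : ℂ) := by
  have h0 : 1 + Complex.exp (2 * φ * Complex.I) ≠ 0 := by
    rw [← norm_ne_zero_iff, norm_one_add_exp]; positivity
  have hc : (Real.cos φ : ℂ) ≠ 0 := by exact_mod_cast hφ
  rw [discToHalfPlane, div_eq_iff h0, Real.tan_eq_sin_div_cos]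
  have e : Complex.exp (2 * φ * Complex.I) = (Real.cos φ + Real.sin φ * Complex.I) ^ 2 := by
    rw [Complex.ofReal_cos, Complex.ofReal_sin, ← Complex.exp_mul_I, ← Complex.exp_nat_mul]
    push_cast; ring_nf
  have hsc : (Real.sin φ : ℂ) ^ 2 + (Real.cos φ : ℂ) ^ 2 = 1 := by
    exact_mod_cast Real.sin_sq_add_cos_sq φ
  rw [e]
  conv_lhs => rw [← Complex.re_add_im γ]
  simp only [map_add, map_mul, Complex.conj_ofReal, Complex.conj_I]
  push_cast [-Complex.ofReal_cos, -Complex.ofReal_sin]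
  generalize (Real.sin φ : ℂ) = s at *
  generalize (Real.cos φ : ℂ) = c at *
  have hI := Complex.I_sq
  field_simp
  grind

/-- An integrable majorant, uniform in the radius, for `‖log (discToHalfPlane γ w)‖ ^ 2` on circles
about the origin. -/
noncomputable def logBound (γ : ℂ) (φ : ℝ) : ℝ :=
  16 * ((2 * ‖γ‖) ^ (1 / 2 : ℝ) * |Real.cos (φ - 0)| ^ (-(1 / 2) : ℝ) +
    (‖γ‖ / 2) ^ (-(1 / 2) : ℝ) * |Real.cos (φ - Complex.arg γ)| ^ (-(1 / 2) : ℝ)) + π ^ 2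

lemma intervalIntegrable_logBound (γ : ℂ) (a b : ℝ) :
    IntervalIntegrable (logBound γ) volume a b :=
  ((((intervalIntegrable_abs_cos_sub_rpow 0 a b).const_mul _).add
    ((intervalIntegrable_abs_cos_sub_rpow γ.arg a b).const_mul _)).const_mul 16).add
    intervalIntegrable_const

/-- The modulus is large only near the zero of the denominator and small only near that of the
numerator; `sq_log_le` turns the two one-sided bounds into integrable powers, and the argument
contributes at most `π ^ 2`. -/
lemma norm_log_discToHalfPlane_sq_le (hγ : γ ≠ 0) {φ : ℝ} (h1 : Real.cos φ ≠ 0)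
    (h2 : Real.cos (φ - Complex.arg γ) ≠ 0) {r : ℝ} (hr0 : 0 ≤ r) (hr1 : r ≤ 1) :
    ‖Complex.log (discToHalfPlane γ (r * Complex.exp (2 * φ * Complex.I)))‖ ^ 2 ≤
      logBound γ φ := by
  have hγ' : 0 < ‖γ‖ := norm_pos_iff.2 hγ
  have h1' : 0 < |Real.cos φ| := abs_pos.2 h1
  have h2' : 0 < |Real.cos (φ - Complex.arg γ)| := abs_pos.2 h2
  set u := Complex.exp (2 * φ * Complex.I) with hu
  have hun : ‖u‖ = 1 := by
    rw [hu, show (2 * φ * Complex.I : ℂ) = ((2 * φ : ℝ) : ℂ) * Complex.I by push_cast; ring,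
      Complex.norm_exp_ofReal_mul_I]
  have d1 : |Real.cos φ| ≤ ‖1 + r * u‖ := by
    have := norm_add_le_two_mul_norm_add_smul (a := 1) (b := u) (by simp [hun]) hr0 hr1
    rw [norm_one_add_exp] at this
    linarith
  have d2 : ‖1 + r * u‖ ≤ 2 := by
    refine (norm_add_le _ _).trans ?_
    rw [norm_mul, hun, Complex.norm_real, Real.norm_of_nonneg hr0]
    simp; linarith
  have n1 : ‖γ‖ * |Real.cos (φ - Complex.arg γ)| ≤ ‖γ + conj γ * (r * u)‖ := by
    have := norm_add_le_two_mul_norm_add_smul (a := γ) (b := conj γ * u) (by simp [hun]) hr0 hr1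
    rw [norm_add_conj_mul_exp] at this
    rw [show conj γ * (r * u) = r * (conj γ * u) by ring]
    linarith
  have n2 : ‖γ + conj γ * (r * u)‖ ≤ 2 * ‖γ‖ := by
    refine (norm_add_le _ _).trans ?_
    rw [norm_mul, norm_mul, hun, Complex.norm_real, Real.norm_of_nonneg hr0, RCLike.norm_conj]
    nlinarith
  set y := ‖discToHalfPlane γ (r * u)‖ with hy
  have hydef : y = ‖γ + conj γ * (r * u)‖ / ‖1 + r * u‖ := by
    rw [hy, discToHalfPlane, norm_div]
  have dpos : 0 < ‖1 + r * u‖ := h1'.trans_le d1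
  have npos : 0 < ‖γ + conj γ * (r * u)‖ := lt_of_lt_of_le (by positivity) n1
  have hy0 : 0 < y := by rw [hydef]; positivity
  have yu : y ≤ 2 * ‖γ‖ * |Real.cos φ|⁻¹ := by
    rw [hydef, div_eq_mul_inv]; gcongr
  have yl : ‖γ‖ / 2 * |Real.cos (φ - Complex.arg γ)| ≤ y := by
    rw [hydef, le_div_iff₀ dpos]
    calc _ ≤ ‖γ‖ / 2 * |Real.cos (φ - Complex.arg γ)| * 2 := by gcongr
      _ ≤ _ := by linarith
  have b1 : y ^ (1 / 2 : ℝ) ≤ (2 * ‖γ‖) ^ (1 / 2 : ℝ) * |Real.cos φ| ^ (-(1 / 2) : ℝ) := by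
    refine (Real.rpow_le_rpow hy0.le yu (by norm_num)).trans_eq ?_
    rw [Real.mul_rpow (by positivity) (by positivity), Real.inv_rpow h1'.le, Real.rpow_neg h1'.le]
  have b2 : y ^ (-(1 / 2) : ℝ) ≤
      (‖γ‖ / 2) ^ (-(1 / 2) : ℝ) * |Real.cos (φ - Complex.arg γ)| ^ (-(1 / 2) : ℝ) := by
    rw [← Real.mul_rpow (by positivity) h2'.le]
    exact Real.rpow_le_rpow_of_nonpos (by positivity) yl (by norm_num)
  have b3 := sq_log_le hy0
  have b4 : Complex.arg (discToHalfPlane γ (r * u)) ^ 2 ≤ π ^ 2 := by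
    rw [← sq_abs (Complex.arg _)]
    exact pow_le_pow_left₀ (abs_nonneg _) (Complex.abs_arg_le_pi _) 2
  rw [Complex.sq_norm, Complex.normSq_apply, Complex.log_re, Complex.log_im, ← sq, ← sq, ← hy,
    logBound, sub_zero]
  linarith

/-- On the negative axis the principal logarithm is continuous only from above, which suffices
because the Möbius map stays in the upper half plane. -/
lemma continuousWithinAt_log_ofReal {x : ℝ} (hx : x ≠ 0) :
    ContinuousWithinAt Complex.log {z | 0 ≤ z.im} (x : ℂ) := by
  rcases lt_or_gt_of_ne hx with h | h
  · exact Complex.continuousWithinAt_log_of_re_neg_of_im_zero (by simpa) (by simp)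
  · exact (continuousAt_clog (Or.inl (by simpa))).continuousWithinAt

lemma ae_cos_sub_ne_zero (a : ℝ) : ∀ᵐ φ : ℝ, Real.cos (φ - a) ≠ 0 := by
  have hc : {φ : ℝ | Real.cos (φ - a) = 0}.Countable := by
    refine (countable_range fun k : ℤ => (2 * k + 1) * π / 2 + a).mono ?_
    intro φ hφ
    obtain ⟨k, hk⟩ := Real.cos_eq_zero_iff.1 hφ
    exact ⟨k, by simp only; linarith⟩
  simpa [ae_iff] using hc.measure_zero volume

lemma tendsto_log_discToHalfPlane (hγ : 0 < γ.im) {φ : ℝ} (h1 : Real.cos φ ≠ 0)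
    (h2 : Real.cos (φ - Complex.arg γ) ≠ 0) :
    Tendsto (fun r : ℝ => Complex.log (discToHalfPlane γ (r * Complex.exp (2 * φ * Complex.I))))
      (𝓝[Ioo 0 1] 1) (𝓝 (Complex.log ((γ.re + γ.im * Real.tan φ : ℝ) : ℂ))) := by
  have hd : 1 + Complex.exp (2 * φ * Complex.I) ≠ 0 := by
    rw [← norm_ne_zero_iff, norm_one_add_exp]; positivity
  have hγ0 : γ ≠ 0 := by rintro rfl; simp at hγ
  have hx : γ.re + γ.im * Real.tan φ ≠ 0 := by
    intro h
    have h3 := discToHalfPlane_exp γ h1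
    rw [h, Complex.ofReal_zero, discToHalfPlane, div_eq_zero_iff, or_iff_left hd,
      ← norm_eq_zero, norm_add_conj_mul_exp] at h3
    have : 0 < ‖γ‖ := norm_pos_iff.2 hγ0
    have : 0 < |Real.cos (φ - γ.arg)| := abs_pos.2 h2
    have : 0 < 2 * (‖γ‖ * |Real.cos (φ - γ.arg)|) := by positivity
    exact this.ne' h3
  have hcont : ContinuousAt
      (fun r : ℝ => discToHalfPlane γ (r * Complex.exp (2 * φ * Complex.I))) 1 := by
    unfold discToHalfPlane
    exact ContinuousAt.div (by fun_prop) (by fun_prop) (by simpa using hd)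
  have ht : Tendsto (fun r : ℝ => discToHalfPlane γ (r * Complex.exp (2 * φ * Complex.I)))
      (𝓝[Ioo 0 1] 1) (𝓝 ((γ.re + γ.im * Real.tan φ : ℝ) : ℂ)) := by
    have := hcont.tendsto
    rw [Complex.ofReal_one, one_mul, discToHalfPlane_exp γ h1] at this
    exact this.mono_left nhdsWithin_le_nhds
  refine (continuousWithinAt_log_ofReal hx).tendsto.comp
    (tendsto_nhdsWithin_iff.2 ⟨ht, ?_⟩)
  filter_upwards [self_mem_nhdsWithin] with r hr
  refine (discToHalfPlane_im_pos hγ ?_).le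
  rw [norm_mul, show (2 * φ * Complex.I : ℂ) = ((2 * φ : ℝ) : ℂ) * Complex.I by push_cast; ring,
    Complex.norm_exp_ofReal_mul_I, Complex.norm_real, Real.norm_of_nonneg hr.1.le, mul_one]
  exact hr.2

/-- Mean value property at the centre: `2φ` covers the circle once, whence the factor `π`. -/
lemma setIntegral_circle_eq {f : ℂ → ℂ} (hf : DifferentiableOn ℂ f (Metric.ball 0 1)) {r : ℝ}
    (hr : r ∈ Ioo 0 1) :
    ∫ φ in Ioo (-(π / 2)) (π / 2), f (r * Complex.exp (2 * φ * Complex.I)) = π * f 0 := by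
  have h1 : DiffContOnCl ℂ f (Metric.ball 0 |r|) := by
    refine DifferentiableOn.diffContOnCl (hf.mono ?_)
    refine Metric.closure_ball_subset_closedBall.trans (Metric.closedBall_subset_ball ?_)
    rw [abs_of_pos hr.1]; exact hr.2
  have h2 := h1.circleAverage
  rw [circleAverage_def] at h2
  have hper : Function.Periodic (fun θ : ℝ => f (circleMap 0 r θ)) (2 * π) := fun θ => by
    simp only [periodic_circleMap 0 r θ]
  have h3 := hper.intervalIntegral_add_eq 0 (-π)
  rw [zero_add, show -π + 2 * π = π by ring] at h3
  have h4 := intervalIntegral.integral_comp_mul_left (fun θ : ℝ => f (circleMap 0 r θ))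
    (a := -(π / 2)) (b := π / 2) (c := 2) two_ne_zero
  rw [show 2 * -(π / 2) = -π by ring, show 2 * (π / 2) = π by ring, ← h3] at h4
  rw [intervalIntegral.integral_of_le (by linarith [Real.pi_pos]), integral_Ioc_eq_integral_Ioo]
    at h4
  have h5 : ∀ φ : ℝ, circleMap 0 r (2 * φ) = r * Complex.exp (2 * φ * Complex.I) := fun φ => by
    simp [circleMap]
  simp only [h5] at h4
  rw [h4, ← h2]
  simp only [Complex.real_smul]
  push_cast
  field_simp

lemma integrableOn_logBound (γ : ℂ) : IntegrableOn (logBound γ) (Ioo (-(π / 2)) (π / 2)) :=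
  ((intervalIntegrable_iff_integrableOn_Ioo_of_le (by linarith [Real.pi_pos])).1
    (intervalIntegrable_logBound γ _ _))

lemma ae_norm_log_discToHalfPlane_sq_le (hγ : γ ≠ 0) :
    ∀ᵐ φ : ℝ ∂(volume.restrict (Ioo (-(π / 2)) (π / 2))), ∀ r : ℝ, 0 ≤ r → r ≤ 1 →
      ‖Complex.log (discToHalfPlane γ (r * Complex.exp (2 * φ * Complex.I)))‖ ^ 2 ≤
        logBound γ φ := by
  filter_upwards [ae_restrict_mem measurableSet_Ioo,
    ae_restrict_of_ae (ae_cos_sub_ne_zero γ.arg)] with φ h1 h2 r hr0 hr1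
  exact norm_log_discToHalfPlane_sq_le hγ (Real.cos_pos_of_mem_Ioo h1).ne' h2 hr0 hr1

lemma norm_pow_le_one_add {z : ℂ} {b : ℝ} {m : ℕ} (hm : m ≤ 2) (h : ‖z‖ ^ 2 ≤ b) :
    ‖z ^ m‖ ≤ 1 + b := by
  rw [norm_pow]
  interval_cases m
  · simp only [pow_zero]; nlinarith [sq_nonneg ‖z‖]
  · nlinarith [sq_nonneg (‖z‖ - 1), norm_nonneg z]
  · linarith

/-- The circle integrals do not depend on `r < 1`; dominated convergence as `r → 1` carries their
value to the boundary. The majorant controls the square of the logarithm, hence `m ≤ 2`. -/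
lemma setIntegral_log_pow (hγ : 0 < γ.im) {m : ℕ} (hm : m ≤ 2) :
    ∫ φ in Ioo (-(π / 2)) (π / 2), Complex.log ((γ.re + γ.im * Real.tan φ : ℝ) : ℂ) ^ m =
      π * Complex.log γ ^ m := by
  have hγ0 : γ ≠ 0 := by rintro rfl; simp at hγ
  have hlim : Tendsto (fun r : ℝ => ∫ φ in Ioo (-(π / 2)) (π / 2),
      Complex.log (discToHalfPlane γ (r * Complex.exp (2 * φ * Complex.I))) ^ m) (𝓝[Ioo 0 1] 1)
      (𝓝 (∫ φ in Ioo (-(π / 2)) (π / 2),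
        Complex.log ((γ.re + γ.im * Real.tan φ : ℝ) : ℂ) ^ m)) := by
    refine MeasureTheory.tendsto_integral_filter_of_dominated_convergence
      (fun φ => 1 + logBound γ φ) ?_ ?_ ?_ ?_
    · refine Eventually.of_forall fun r => Measurable.aestronglyMeasurable ?_
      unfold discToHalfPlane
      fun_prop
    · filter_upwards [self_mem_nhdsWithin] with r hr
      filter_upwards [ae_norm_log_discToHalfPlane_sq_le hγ0] with φ h
      exact norm_pow_le_one_add hm (h r hr.1.le hr.2.le)
    · exact (integrable_const _).add (integrableOn_logBound γ)
    · filter_upwards [ae_restrict_mem measurableSet_Ioo,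
        ae_restrict_of_ae (ae_cos_sub_ne_zero γ.arg)] with φ h1 h2
      exact (tendsto_log_discToHalfPlane hγ (Real.cos_pos_of_mem_Ioo h1).ne' h2).pow m
  have hne : (𝓝[Ioo (0 : ℝ) 1] 1).NeBot := by
    rw [← mem_closure_iff_nhdsWithin_neBot, closure_Ioo zero_ne_one]
    simp
  refine tendsto_nhds_unique hlim (tendsto_const_nhds.congr' ?_)
  filter_upwards [self_mem_nhdsWithin] with r hr
  rw [setIntegral_circle_eq (differentiableOn_log_discToHalfPlane_pow hγ m) hr]
  simp [discToHalfPlane]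

lemma integrableOn_norm_log_sq (hγ : 0 < γ.im) :
    IntegrableOn (fun φ => ‖Complex.log ((γ.re + γ.im * Real.tan φ : ℝ) : ℂ)‖ ^ 2)
      (Ioo (-(π / 2)) (π / 2)) := by
  have hγ0 : γ ≠ 0 := by rintro rfl; simp at hγ
  refine (integrableOn_logBound γ).mono' (Measurable.aestronglyMeasurable ?_) ?_
  · have : Measurable Real.tan := by
      simp only [funext Real.tan_eq_sin_div_cos]; fun_prop
    fun_prop
  · filter_upwards [ae_restrict_mem measurableSet_Ioo, ae_norm_log_discToHalfPlane_sq_le hγ0]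
      with φ h1 h
    -- The majorant includes the endpoint `r = 1`, where the Möbius map takes its real boundary
    -- values.
    have := h 1 zero_le_one le_rfl
    rw [Complex.ofReal_one, one_mul, discToHalfPlane_exp γ (Real.cos_pos_of_mem_Ioo h1).ne']
      at this
    rwa [norm_pow, norm_norm]

section Cauchy
variable {μ : ℝ} {σ : NNReal}

lemma measurable_log_ofReal : Measurable (fun x : ℝ => Complex.log (x : ℂ)) := by fun_prop

lemma memLp_log_cauchyMeasure (hσ : 0 < σ) :
    MemLp (fun x : ℝ => Complex.log (x : ℂ)) 2 (cauchyMeasure μ σ) := by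
  rw [memLp_two_iff_integrable_sq_norm measurable_log_ofReal.aestronglyMeasurable,
    integrable_cauchyMeasure_iff hσ]
  exact integrableOn_norm_log_sq (γ := ⟨μ, σ⟩) (NNReal.coe_pos.2 hσ)

lemma integral_log_pow_cauchyMeasure (hσ : 0 < σ) {m : ℕ} (hm : m ≤ 2) :
    ∫ x, Complex.log (x : ℂ) ^ m ∂(cauchyMeasure μ σ) = Complex.log ⟨μ, σ⟩ ^ m := by
  rw [integral_cauchyMeasure hσ]
  have := setIntegral_log_pow (γ := ⟨μ, σ⟩) (NNReal.coe_pos.2 hσ) hm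
  simp only at this
  rw [this, Complex.real_smul]
  push_cast
  field_simp

end Cauchy
end CauchyGM

/-! ### Central limit theorem in the plane -/

namespace CauchyGM
open Set ComplexConjugate

section CLT
variable {Ω : Type*} [MeasurableSpace Ω] {P : Measure Ω}

lemma exists_unit_smul (t : ℂ) : ∃ u : ℂ, ‖u‖ = 1 ∧ t = (‖t‖ : ℝ) • u := by
  rcases eq_or_ne t 0 with rfl | h
  · exact ⟨1, by simp, by simp⟩
  · have : ‖t‖ ≠ 0 := norm_ne_zero_iff.2 h
    refine ⟨(‖t‖⁻¹ : ℝ) • t, ?_, ?_⟩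
    · rw [norm_smul, norm_inv, norm_norm, inv_mul_cancel₀ this]
    · rw [smul_smul, mul_inv_cancel₀ this, one_smul]

/-- The Cramér–Wold reduction to one-dimensional projections. -/
lemma charFun_map_smul_eq_charFun_map_inner {S : Ω → ℂ} (hS : AEMeasurable S P) (r : ℝ) (u : ℂ) :
    charFun (P.map S) (r • u) = charFun (P.map fun ω => inner ℝ (S ω) u) r := by
  rw [charFun_apply, charFun_apply_real, integral_map hS (by fun_prop),
    integral_map (by fun_prop) (by fun_prop)]
  simp only [inner_smul_right]
  push_cast
  rfl

variable [IsProbabilityMeasure P]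

/-- The central limit theorem for centred complex random variables whose relation
`E[W ^ 2]` vanishes: the normalised sums converge to a standard Gaussian on the plane. -/
theorem tendstoInDistribution_inv_sqrt_smul_sum_complex {W : ℕ → Ω → ℂ}
    (hW : MemLp (W 0) 2 P) (h0 : ∫ ω, W 0 ω ∂P = 0) (h1 : ∫ ω, W 0 ω ^ 2 ∂P = 0)
    (h2 : ∫ ω, ‖W 0 ω‖ ^ 2 ∂P = 2) (hindep : iIndepFun W P)
    (hident : ∀ i, IdentDistrib (W i) (W 0) P P) :
    TendstoInDistribution (fun (n : ℕ) ω => (Real.sqrt n)⁻¹ • ∑ j ∈ Finset.range n, W j ω) atTop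
      (id : ℂ → ℂ) (fun _ => P) (stdGaussian ℂ) where
  forall_aemeasurable n :=
    (Finset.aemeasurable_fun_sum (Finset.range n) fun j _ =>
      (hident j).aemeasurable_fst).const_smul (Real.sqrt n)⁻¹
  aemeasurable_limit := aemeasurable_id
  tendsto := by
    refine ProbabilityMeasure.tendsto_iff_tendsto_charFun.2 fun t => ?_
    simp only [ProbabilityMeasure.coe_mk, Measure.map_id]
    obtain ⟨u, hu, ht⟩ := exists_unit_smul t
    have hmeas : ∀ n : ℕ, AEMeasurable
        (fun ω => (Real.sqrt n)⁻¹ • ∑ j ∈ Finset.range n, W j ω) P := fun n =>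
      (Finset.aemeasurable_fun_sum (Finset.range n) fun j _ =>
      (hident j).aemeasurable_fst).const_smul (Real.sqrt n)⁻¹
    have hsum : ∀ n : ℕ, charFun
        (P.map fun ω => (Real.sqrt n)⁻¹ • ∑ j ∈ Finset.range n, W j ω) t =
        charFun (P.map (fun ω => inner ℝ (W 0 ω) u)) ((Real.sqrt n)⁻¹ * ‖t‖) ^ n := by
      intro n
      have hi : iIndepFun (fun j ω => inner ℝ (W j ω) u) P :=
        hindep.comp (fun _ w => inner ℝ w u) (by fun_prop)
      have hd : ∀ j, IdentDistrib (fun ω => inner ℝ (W j ω) u) (fun ω => inner ℝ (W 0 ω) u) P P :=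
        fun j => (hident j).comp (u := fun w => inner ℝ w u) (by fun_prop)
      rw [← charFun_inv_sqrt_mul_sum (X := fun j ω => inner ℝ (W j ω) u) hi hd]
      conv_lhs => rw [ht]
      rw [charFun_map_smul_eq_charFun_map_inner (hmeas n)]
      simp only [real_inner_smul_left, sum_inner]
    simp only [hsum]
    rw [charFun_stdGaussian]
    have hint : Integrable (W 0) P := hW.integrable one_le_two
    have hsq : Integrable (fun ω => ‖W 0 ω‖ ^ 2) P := hW.integrable_norm_pow two_ne_zero
    have hsq' : Integrable (fun ω => W 0 ω ^ 2) P := by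
      refine hsq.mono (hW.1.pow 2) (ae_of_all _ fun ω => ?_)
      simp
    have e0 : ∫ ω, inner ℝ (W 0 ω) u ∂P = 0 := by
      simp only [real_inner_comm u]
      rw [integral_inner hint, h0, inner_zero_right]
    have e2 : ∫ ω, (inner ℝ (W 0 ω) u) ^ 2 ∂P = 1 := by
      -- The second term has mean zero because `E[W ^ 2] = 0`, so every projection has the same
      -- variance `1`.
      have key : ∀ w : ℂ, (inner ℝ w u) ^ 2 =
          1 / 2 * ‖w‖ ^ 2 + 1 / 2 * (conj u ^ 2 * w ^ 2).re := by
        intro w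
        have hu' : u.re * u.re + u.im * u.im = 1 := by
          rw [← Complex.normSq_apply, ← Complex.sq_norm, hu, one_pow]
        rw [Complex.inner, Complex.sq_norm, Complex.normSq_apply, sq, sq, sq]
        simp only [Complex.mul_re, Complex.mul_im, Complex.conj_re, Complex.conj_im]
        linear_combination (1 / 2 : ℝ) * (w.re * w.re + w.im * w.im) * hu'
      have hre : ∫ ω, (conj u ^ 2 * W 0 ω ^ 2).re ∂P = 0 := by
        have := integral_re (𝕜 := ℂ) (hsq'.const_mul (conj u ^ 2))
        simp only [RCLike.re_eq_complex_re] at this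
        rw [this, integral_const_mul, h1]
        simp
      have hre' : Integrable (fun ω => (conj u ^ 2 * W 0 ω ^ 2).re) P :=
        (hsq'.const_mul (conj u ^ 2)).re
      simp only [key]
      rw [integral_add (hsq.const_mul _) (hre'.const_mul _), integral_const_mul,
        integral_const_mul, h2, hre]
      norm_num
    have := tendsto_charFun_inv_sqrt_mul_pow (P := P) (X := fun ω => inner ℝ (W 0 ω) u)
      (hW.1.aemeasurable.inner_const) e0 (by simpa using e2) ‖t‖
    exact this

end CLT

/-! ### Gaussian mass of centred squares -/

section Gaussian

lemma gaussianReal_real_Iic {a ρ : ℝ} (h : IsUpperNormalQuantile a ρ) :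
    (gaussianReal 0 1).real (Iic ρ) = 1 - a := by
  have e : ∫ x in Iic ρ, gaussianPDFReal 0 1 x = 1 - a := by
    rw [← h]
    refine integral_congr_ae (ae_of_all _ fun x => ?_)
    simp [gaussianPDFReal]
  rw [measureReal_def, gaussianReal_apply_eq_integral 0 one_ne_zero, e, ENNReal.toReal_ofReal]
  rw [← e]
  exact integral_nonneg fun x => gaussianPDFReal_nonneg _ _ _

lemma gaussianReal_real_Icc {a ρ : ℝ} (ha : a ≤ 1 / 2) (h : IsUpperNormalQuantile a ρ) :
    (gaussianReal 0 1).real (Icc (-ρ) ρ) = 1 - 2 * a := by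
  have := nullSingletonClass_gaussianReal (μ := 0) (v := 1) one_ne_zero
  have h1 := gaussianReal_real_Iic h
  have h2 : (gaussianReal 0 1).real (Iio (-ρ)) = a := by
    have hm : (gaussianReal 0 1).real (Iio (-ρ)) = (gaussianReal 0 1).real (Ioi ρ) := by
      conv_lhs => rw [← neg_zero (G := ℝ), ← gaussianReal_map_neg]
      rw [map_measureReal_apply (by fun_prop) measurableSet_Iio]
      congr 1
      ext x; simp
    rw [hm, ← compl_Iic, probReal_compl_eq_one_sub measurableSet_Iic, h1]
    ring
  rcases le_or_gt 0 ρ with hρ | hρ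
  · have hd : Icc (-ρ) ρ = Iic ρ \ Iio (-ρ) := by
      ext x; simp [and_comm]
    have hs : Iio (-ρ) ⊆ Iic ρ := fun x hx => (mem_Iio.1 hx).le.trans (neg_le_self hρ)
    rw [hd, measureReal_sdiff hs measurableSet_Iio, h1, h2]
    ring
  -- A negative `ρ` would give `1 - a ≤ a`, so `a = 1 / 2` and both sides are `0`.
  · have hle : (gaussianReal 0 1).real (Iic ρ) ≤ (gaussianReal 0 1).real (Iio (-ρ)) :=
      measureReal_mono fun x hx => lt_of_le_of_lt (mem_Iic.1 hx) (by linarith)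
    rw [Icc_eq_empty (by linarith), measureReal_empty]
    linarith

lemma stdGaussian_complex_real_reProdIm {s t : Set ℝ} (hs : MeasurableSet s)
    (ht : MeasurableSet t) :
    (stdGaussian ℂ).real (s ×ℂ t) = (gaussianReal 0 1).real s * (gaussianReal 0 1).real t := by
  have hst : MeasurableSet (s ×ℂ t) := (Complex.measurable_re hs).inter (Complex.measurable_im ht)
  rw [stdGaussian_eq_map_pi_orthonormalBasis Complex.orthonormalBasisOneI,
    map_measureReal_apply (by fun_prop) hst]
  have : (fun x : Fin 2 → ℝ => ∑ i, x i • Complex.orthonormalBasisOneI i) ⁻¹' (s ×ℂ t) =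
      univ.pi ![s, t] := by
    ext x
    simp [Complex.mem_reProdIm, Fin.forall_fin_two]
  rw [this, measureReal_def, Measure.pi_pi, ENNReal.toReal_prod]
  simp [measureReal_def]

lemma stdGaussian_frontier_reProdIm_Icc (ρ : ℝ) :
    stdGaussian ℂ (frontier (Icc (-ρ) ρ ×ℂ Icc (-ρ) ρ)) = 0 := by
  have := nullSingletonClass_gaussianReal (μ := 0) (v := 1) one_ne_zero
  have hz : (gaussianReal 0 1).real {-ρ, ρ} = 0 := by
    rw [measureReal_def, ((finite_singleton ρ).insert (-ρ)).measure_zero, ENNReal.toReal_zero]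
  have hf : frontier (Icc (-ρ) ρ) ⊆ {-ρ, ρ} := by
    rcases le_or_gt (-ρ) ρ with h | h
    · rw [frontier_Icc h]
    · rw [Icc_eq_empty (by linarith), frontier_empty]; exact empty_subset _
  have hsub : frontier (Icc (-ρ) ρ ×ℂ Icc (-ρ) ρ) ⊆ univ ×ℂ {-ρ, ρ} ∪ {-ρ, ρ} ×ℂ univ := by
    rw [Complex.frontier_reProdIm]
    exact union_subset_union (fun z hz => ⟨mem_univ _, hf hz.2⟩) fun z hz => ⟨hf hz.1, mem_univ _⟩
  have hfin : MeasurableSet ({-ρ, ρ} : Set ℝ) := (toFinite _).measurableSet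
  refine measure_mono_null hsub (measure_union_null ?_ ?_)
  · rw [← measureReal_eq_zero_iff, stdGaussian_complex_real_reProdIm .univ hfin, hz, mul_zero]
  · rw [← measureReal_eq_zero_iff, stdGaussian_complex_real_reProdIm hfin .univ, hz, zero_mul]

end Gaussian
end CauchyGM

/-! ### Branches of the logarithm, empirical variance, and tools for the delta method -/

namespace CauchyGM
open Set

/-- A real number has argument `0` or `π`, where the `[0, 2π)` and principal conventions agree. -/
lemma branchLog_ofReal (k : ℤ) (x : ℝ) :
    branchLog k (x : ℂ) = Complex.log (x : ℂ) + 2 * k * Real.pi * Complex.I := by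
  have h : argNonneg (x : ℂ) = Complex.arg (x : ℂ) := by
    rw [argNonneg, if_pos]
    rcases le_or_gt 0 x with h | h
    · rw [Complex.arg_ofReal_of_nonneg h]
    · rw [Complex.arg_ofReal_of_neg h]; exact Real.pi_pos.le
  rw [branchLog, h, Complex.log]
  push_cast
  ring

/-- The `N` branch shifts, each weighted `1 / N`, add up to `2kπi`, which the exponential kills. -/
lemma geomMean_eq_exp (k : ℤ) {N : ℕ} (hN : N ≠ 0) (x : ℕ → ℝ) (γ : ℂ) (hγ : γ ≠ 0) :
    geomMean k N x = γ * Complex.exp ((N : ℝ)⁻¹ •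
      ∑ j ∈ Finset.range N, (Complex.log (x j : ℂ) - Complex.log γ)) := by
  have hN' : (N : ℂ) ≠ 0 := Nat.cast_ne_zero.2 hN
  conv_rhs => lhs; rw [← Complex.exp_log hγ]
  simp only [geomMean, branchPow, branchLog_ofReal]
  rw [← Complex.exp_sum, ← Complex.exp_add, Complex.exp_eq_exp_iff_exists_int]
  refine ⟨k, ?_⟩
  rw [← Finset.mul_sum, Finset.sum_add_distrib, Finset.sum_sub_distrib]
  simp only [Finset.sum_const, Finset.card_range, nsmul_eq_mul, Complex.real_smul]
  push_cast
  field_simp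
  ring

/-- The argument of `γ` lies strictly between `0` and `π`, while a real number has argument `0` or
`π`. This keeps the limiting variance positive. -/
lemma log_ofReal_sub_log_ne_zero {γ : ℂ} (hγ : 0 < γ.im) (x : ℝ) :
    Complex.log (x : ℂ) - Complex.log γ ≠ 0 := by
  intro h
  have h1 := congrArg Complex.im (sub_eq_zero.1 h)
  rw [Complex.log_im, Complex.log_im] at h1
  have h2 : γ.arg ≠ Real.pi := fun h => hγ.ne' (Complex.arg_eq_pi_iff.1 h).2
  have h3 : γ.arg ≠ 0 := fun h => hγ.ne' (Complex.arg_eq_zero_iff.1 h).2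
  rcases le_or_gt 0 x with h | h
  · rw [Complex.arg_ofReal_of_nonneg h] at h1; exact h3 h1.symm
  · rw [Complex.arg_ofReal_of_neg h] at h1; exact h2 h1.symm

section Variance
variable {Ω : Type*} [MeasurableSpace Ω] {P : Measure Ω} [IsProbabilityMeasure P]

lemma integral_norm_add_const_sq {Z : Ω → ℂ} (hZ : MemLp Z 2 P) (h0 : ∫ ω, Z ω ∂P = 0) (a : ℂ) :
    ∫ ω, ‖Z ω + a‖ ^ 2 ∂P = ∫ ω, ‖Z ω‖ ^ 2 ∂P + ‖a‖ ^ 2 := by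
  have hint : Integrable Z P := hZ.integrable one_le_two
  have hsq : Integrable (fun ω => ‖Z ω‖ ^ 2) P := hZ.integrable_norm_pow two_ne_zero
  have hin : Integrable (fun ω => inner ℝ a (Z ω)) P := hint.const_inner a
  have h1 : ∀ ω, ‖Z ω + a‖ ^ 2 = ‖Z ω‖ ^ 2 + 2 * inner ℝ a (Z ω) + ‖a‖ ^ 2 := fun ω => by
    rw [norm_add_sq_real, real_inner_comm]
  simp only [h1]
  have hadd : Integrable (fun ω => ‖Z ω‖ ^ 2 + 2 * inner ℝ a (Z ω)) P :=
    hsq.add (hin.const_mul 2)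
  rw [integral_add hadd (integrable_const _),
    integral_add hsq (hin.const_mul 2), integral_const_mul, integral_inner hint, h0]
  simp

/-- Almost sure convergence of the empirical variance of complex random variables. -/
lemma ae_tendsto_empirical_variance {B : ℕ → Ω → ℂ} (hB : MemLp (B 0) 2 P)
    (hindep : iIndepFun B P) (hident : ∀ i, IdentDistrib (B i) (B 0) P P) :
    ∀ᵐ ω ∂P, Tendsto (fun N : ℕ => 1 / ((N : ℝ) - 1) * ∑ j ∈ Finset.range N, ‖B j ω‖ ^ 2
      - ‖1 / (N : ℂ) * ∑ j ∈ Finset.range N, B j ω‖ ^ 2) atTop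
      (𝓝 (∫ ω, ‖B 0 ω‖ ^ 2 ∂P - ‖∫ ω, B 0 ω ∂P‖ ^ 2)) := by
  have s1 := strong_law_ae B (hB.integrable one_le_two) (fun i j h => hindep.indepFun h) hident
  have s2 := strong_law_ae (μ := P) (fun j ω => ‖B j ω‖ ^ 2)
    (hB.integrable_norm_pow two_ne_zero)
    (fun i j h => (hindep.indepFun h).comp (φ := fun z : ℂ => ‖z‖ ^ 2)
      (ψ := fun z : ℂ => ‖z‖ ^ 2) (by fun_prop) (by fun_prop))
    (fun i => (hident i).comp (u := fun z : ℂ => ‖z‖ ^ 2) (by fun_prop))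
  have hr : Tendsto (fun N : ℕ => (N : ℝ) / ((N : ℝ) - 1)) atTop (𝓝 1) := by
    have := (tendsto_natCast_div_add_atTop (𝕜 := ℝ) (-1))
    simpa [sub_eq_add_neg] using this
  filter_upwards [s1, s2] with ω h1 h2
  have h3 := (hr.mul h2).sub (h1.norm.pow 2)
  rw [one_mul] at h3
  refine h3.congr' ?_
  filter_upwards [eventually_ne_atTop 0] with N hN
  have hN' : (N : ℝ) ≠ 0 := Nat.cast_ne_zero.2 hN
  congr 1
  · rw [smul_eq_mul, ← mul_assoc]
    congr 1
    field_simp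
  · rw [Complex.real_smul]
    push_cast
    rw [one_div]

end Variance

lemma mem_square_iff {γ p : ℂ} {q ρ : ℝ} (hq : 0 < q) :
    γ ∈ square p (q * ρ) ↔ q⁻¹ • (p - γ) ∈ Icc (-ρ) ρ ×ℂ Icc (-ρ) ρ := by
  have key : ∀ a b : ℝ, a ∈ Icc (b - q * ρ) (b + q * ρ) ↔ q⁻¹ * (b - a) ∈ Icc (-ρ) ρ := by
    intro a b
    rw [mem_Icc, mem_Icc, inv_mul_le_iff₀ hq, le_inv_mul_iff₀ hq]
    constructor <;> rintro ⟨h1, h2⟩ <;> constructor <;> linarith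
  simp only [square, mem_ofPred_eq, Complex.mem_reProdIm, key, Complex.smul_re, Complex.smul_im,
    Complex.sub_re, Complex.sub_im, smul_eq_mul]

/-- An exact form of the delta method: the linearisation error of `exp` is a factor, continuous and
equal to `1` at `0`, needing no division by `z`. -/
lemma mul_dslope_exp (z : ℂ) : z * dslope Complex.exp 0 z = Complex.exp z - 1 := by
  have := sub_smul_dslope Complex.exp 0 z
  simpa using this

lemma continuous_dslope_exp : Continuous (dslope Complex.exp 0) := by
  rw [← continuousOn_univ, continuousOn_dslope univ_mem]
  exact ⟨Complex.continuous_exp.continuousOn, Complex.differentiableAt_exp⟩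

lemma dslope_exp_zero : dslope Complex.exp 0 0 = 1 := by
  rw [dslope_same, Complex.deriv_exp, Complex.exp_zero]

/-- If two sequences of events agree off events of vanishing probability, their probabilities have
the same limit. -/
lemma tendsto_measureReal_of_agree {Ω : Type*} [MeasurableSpace Ω] {P : Measure Ω}
    [IsProbabilityMeasure P] {A B C : ℕ → Set Ω} {l : ℝ}
    (hB : Tendsto (fun n => P.real (B n)) atTop (𝓝 l))
    (hC : Tendsto (fun n => P.real (C n)) atTop (𝓝 0))
    (h : ∀ᶠ n in atTop, ∀ ω ∉ C n, ω ∈ A n ↔ ω ∈ B n) :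
    Tendsto (fun n => P.real (A n)) atTop (𝓝 l) := by
  have h1 := hB.sub hC
  have h2 := hB.add hC
  rw [sub_zero] at h1
  rw [add_zero] at h2
  have sub : ∀ S T U : Set Ω, (∀ ω ∉ U, ω ∈ S → ω ∈ T) → P.real S ≤ P.real T + P.real U := by
    intro S T U hST
    refine (measureReal_mono fun ω hω => ?_).trans (measureReal_union_le T U)
    by_cases hU : ω ∈ U
    · exact Or.inr hU
    · exact Or.inl (hST ω hU hω)
  refine tendsto_of_tendsto_of_tendsto_of_le_of_le' h1 h2 ?_ ?_
  · filter_upwards [h] with n hn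
    linarith [sub (B n) (A n) (C n) fun ω hω => (hn ω hω).2]
  · filter_upwards [h] with n hn
    exact sub (A n) (B n) (C n) fun ω hω => (hn ω hω).1

end CauchyGM

/-! ### The studentised geometric mean -/

namespace CauchyGM
open Set

section Main
variable {Ω : Type*} [MeasurableSpace Ω] {P : Measure Ω}
  {μ : ℝ} {σ : NNReal} {X : ℕ → Ω → ℝ}

lemma measurable_logVar (hX : ∀ j, Measurable (X j)) (k : ℤ) (N : ℕ) :
    Measurable (fun ω => logVar k N (fun j => X j ω)) := by
  simp only [logVar, branchLog_ofReal]
  fun_prop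

/-- The centred logarithm of the `j`-th variable. -/
noncomputable def centredLog (γ : ℂ) (X : ℕ → Ω → ℝ) (j : ℕ) (ω : Ω) : ℂ :=
  Complex.log (X j ω : ℂ) - Complex.log γ

/-- Half of the variance of the logarithm, that is, the variance of each of its two components. -/
noncomputable def halfVar (P : Measure Ω) (γ : ℂ) (X : ℕ → Ω → ℝ) : ℝ :=
  (∫ ω, ‖centredLog γ X 0 ω‖ ^ 2 ∂P) / 2

lemma measurable_centredLog (γ : ℂ) (hX : ∀ j, Measurable (X j)) (j : ℕ) :
    Measurable (centredLog γ X j) := by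
  unfold centredLog; fun_prop

lemma memLp_log (hσ : 0 < σ) (hlaw : ∀ j, HasLaw (X j) (cauchyMeasure μ σ) P) :
    MemLp (fun ω => Complex.log (X 0 ω : ℂ)) 2 P := by
  have h := memLp_log_cauchyMeasure (μ := μ) hσ
  rw [← (hlaw 0).map_eq] at h
  exact h.comp_of_map (hlaw 0).aemeasurable

lemma integral_log_pow (hσ : 0 < σ) (hlaw : ∀ j, HasLaw (X j) (cauchyMeasure μ σ) P) {m : ℕ}
    (hm : m ≤ 2) : ∫ ω, Complex.log (X 0 ω : ℂ) ^ m ∂P = Complex.log ⟨μ, σ⟩ ^ m := by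
  rw [← integral_log_pow_cauchyMeasure hσ hm]
  exact (hlaw 0).integral_comp (f := fun x : ℝ => Complex.log (x : ℂ) ^ m)
    (measurable_log_ofReal.pow_const m).aestronglyMeasurable

lemma identDistrib_centredLog (hlaw : ∀ j, HasLaw (X j) (cauchyMeasure μ σ) P) (γ : ℂ) (j : ℕ) :
    IdentDistrib (centredLog γ X j) (centredLog γ X 0) P P := by
  have h : IdentDistrib (X j) (X 0) P P :=
    ⟨(hlaw j).aemeasurable, (hlaw 0).aemeasurable, by rw [(hlaw j).map_eq, (hlaw 0).map_eq]⟩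
  exact h.comp (u := fun x : ℝ => Complex.log (x : ℂ) - Complex.log γ) (by fun_prop)

lemma iIndepFun_centredLog (hindep : iIndepFun X P) (γ : ℂ) : iIndepFun (centredLog γ X) P :=
  hindep.comp (fun _ (x : ℝ) => Complex.log (x : ℂ) - Complex.log γ) (by fun_prop)

variable [IsProbabilityMeasure P]

lemma memLp_centredLog (hσ : 0 < σ) (hlaw : ∀ j, HasLaw (X j) (cauchyMeasure μ σ) P) (γ : ℂ) :
    MemLp (centredLog γ X 0) 2 P :=
  (memLp_log hσ hlaw).sub (memLp_const _)

lemma integral_centredLog (hσ : 0 < σ) (hlaw : ∀ j, HasLaw (X j) (cauchyMeasure μ σ) P) :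
    ∫ ω, centredLog ⟨μ, σ⟩ X 0 ω ∂P = 0 := by
  have h1 := integral_log_pow hσ hlaw one_le_two
  simp only [pow_one] at h1
  have hi := (memLp_log hσ hlaw).integrable one_le_two
  simp only [centredLog]
  rw [integral_sub hi (integrable_const _), h1]
  simp

lemma integral_centredLog_sq (hσ : 0 < σ) (hlaw : ∀ j, HasLaw (X j) (cauchyMeasure μ σ) P) :
    ∫ ω, centredLog ⟨μ, σ⟩ X 0 ω ^ 2 ∂P = 0 := by
  have h1 := integral_log_pow hσ hlaw one_le_two
  have h2 := integral_log_pow hσ hlaw le_rfl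
  simp only [pow_one] at h1
  have hL := memLp_log hσ hlaw
  have hi := hL.integrable one_le_two
  have hi2 : Integrable (fun ω => Complex.log (X 0 ω : ℂ) ^ 2) P := by
    refine (hL.integrable_norm_pow two_ne_zero).mono (hL.1.pow 2) (ae_of_all _ fun ω => ?_)
    simp
  have e : ∀ ω, centredLog ⟨μ, σ⟩ X 0 ω ^ 2 = Complex.log (X 0 ω : ℂ) ^ 2 -
      2 * Complex.log ⟨μ, σ⟩ * Complex.log (X 0 ω : ℂ) + Complex.log ⟨μ, σ⟩ ^ 2 := fun ω => by
    rw [centredLog]; ring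
  have hs : Integrable (fun ω => Complex.log (X 0 ω : ℂ) ^ 2 -
      2 * Complex.log ⟨μ, σ⟩ * Complex.log (X 0 ω : ℂ)) P := hi2.sub (hi.const_mul _)
  simp only [e]
  rw [integral_add hs (integrable_const _), integral_sub hi2 (hi.const_mul _),
    integral_const_mul, h1, h2]
  simp
  ring

lemma halfVar_pos (hσ : 0 < σ) (hlaw : ∀ j, HasLaw (X j) (cauchyMeasure μ σ) P) :
    0 < halfVar P ⟨μ, σ⟩ X := by
  refine half_pos (lt_of_le_of_ne (integral_nonneg fun ω => by positivity) fun h => ?_)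
  have hi := (memLp_centredLog hσ hlaw ⟨μ, σ⟩).integrable_norm_pow two_ne_zero
  have hz := (integral_eq_zero_iff_of_nonneg (fun ω => by positivity) hi).1 h.symm
  obtain ⟨ω, hω⟩ := hz.exists
  have : centredLog ⟨μ, σ⟩ X 0 ω = 0 := by simpa using hω
  exact log_ofReal_sub_log_ne_zero (NNReal.coe_pos.2 hσ) _ this

lemma ae_tendsto_logVar (hσ : 0 < σ) (hlaw : ∀ j, HasLaw (X j) (cauchyMeasure μ σ) P)
    (hindep : iIndepFun X P) (k : ℤ) :
    ∀ᵐ ω ∂P, Tendsto (fun N => logVar k N (fun j => X j ω)) atTop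
      (𝓝 (2 * halfVar P ⟨μ, σ⟩ X)) := by
  -- The mean of the `k`-th branch of `log X`; it cancels in the limit since `E|Z + a|^2 - |a|^2 =
  -- E|Z|^2`.
  set a : ℂ := Complex.log ⟨μ, σ⟩ + 2 * k * Real.pi * Complex.I with ha
  have hZ := memLp_centredLog hσ hlaw ⟨μ, σ⟩
  have h := ae_tendsto_empirical_variance (B := fun j ω => centredLog ⟨μ, σ⟩ X j ω + a)
    (hZ.add (memLp_const a))
    ((iIndepFun_centredLog hindep ⟨μ, σ⟩).comp (fun _ z => z + a) (by fun_prop))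
    (fun i => (identDistrib_centredLog hlaw ⟨μ, σ⟩ i).comp (u := fun z => z + a) (by fun_prop))
  rw [integral_norm_add_const_sq hZ (integral_centredLog hσ hlaw),
    integral_add (hZ.integrable one_le_two) (integrable_const _), integral_centredLog hσ hlaw] at h
  have hb : ∀ j ω, branchLog k (X j ω : ℂ) = centredLog ⟨μ, σ⟩ X j ω + a := fun j ω => by
    rw [branchLog_ofReal, centredLog, ha]; ring
  have hl : 2 * halfVar P ⟨μ, σ⟩ X = ∫ ω, ‖centredLog ⟨μ, σ⟩ X 0 ω‖ ^ 2 ∂P := by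
    rw [halfVar]; ring
  simp only [logVar, hb, hl]
  simpa using h

lemma ae_tendsto_mean_centredLog (hσ : 0 < σ) (hlaw : ∀ j, HasLaw (X j) (cauchyMeasure μ σ) P)
    (hindep : iIndepFun X P) :
    ∀ᵐ ω ∂P, Tendsto (fun N : ℕ => (N : ℝ)⁻¹ •
      ∑ j ∈ Finset.range N, centredLog ⟨μ, σ⟩ X j ω) atTop (𝓝 0) := by
  have := strong_law_ae (centredLog ⟨μ, σ⟩ X)
    ((memLp_centredLog hσ hlaw ⟨μ, σ⟩).integrable one_le_two)
    (fun i j h => (iIndepFun_centredLog hindep ⟨μ, σ⟩).indepFun h)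
    (identDistrib_centredLog hlaw ⟨μ, σ⟩)
  rwa [integral_centredLog hσ hlaw] at this

/-- The half side length, per unit of the quantile, of the confidence square. -/
noncomputable def sideScale (k : ℤ) (N : ℕ) (x : ℕ → ℝ) : ℝ :=
  Real.sqrt (logVar k N x) / Real.sqrt (2 * (N : ℝ)) * ‖geomMean k N x‖

/-- The studentised geometric mean is asymptotically a standard Gaussian on the plane. -/
theorem tendstoInDistribution_studentized (hσ : 0 < σ) (hX : ∀ j, Measurable (X j))
    (hlaw : ∀ j, HasLaw (X j) (cauchyMeasure μ σ) P) (hindep : iIndepFun X P) (k : ℤ) :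
    TendstoInDistribution
      (fun (N : ℕ) ω => (sideScale k N (fun j => X j ω))⁻¹ •
        (geomMean k N (fun j => X j ω) - (⟨μ, σ⟩ : ℂ)))
      atTop (id : ℂ → ℂ) (fun _ => P) (stdGaussian ℂ) := by
  set γ : ℂ := ⟨μ, σ⟩ with hγ
  have hγ0 : γ ≠ 0 := fun h => hσ.ne' (by
    have := congrArg Complex.im h
    simpa [hγ] using this)
  have hγn : (‖γ‖ : ℝ) ≠ 0 := norm_ne_zero_iff.2 hγ0
  set v := halfVar P γ X with hv
  have hv0 : 0 < v := halfVar_pos hσ hlaw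
  have hs0 : 0 < Real.sqrt v := Real.sqrt_pos.2 hv0
  -- The rotation `γ / |γ|` comes from dividing the error `γ (exp M - 1)` by a scale proportional to
  -- `|γ|`; the factor `1 / √v` normalises `E|W|^2` to `2`.
  set κ : ℂ := γ / ((‖γ‖ * Real.sqrt v : ℝ) : ℂ) with hκ
  have hκn : ‖κ‖ ^ 2 = v⁻¹ := by
    rw [hκ, norm_div, Complex.norm_real, norm_mul, norm_norm, Real.norm_of_nonneg hs0.le,
      div_pow, mul_pow, Real.sq_sqrt hv0.le]
    field_simp
  have hmZ : ∀ j, Measurable (centredLog γ X j) := measurable_centredLog γ hX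
  have hZ := memLp_centredLog hσ hlaw γ
  have hclt := tendstoInDistribution_inv_sqrt_smul_sum_complex
    (W := fun j ω => κ * centredLog γ X j ω) (P := P) (hZ.const_mul κ)
    (by rw [integral_const_mul, integral_centredLog hσ hlaw, mul_zero])
    (by simp only [mul_pow]; rw [integral_const_mul, integral_centredLog_sq hσ hlaw, mul_zero])
    (by
      simp only [norm_mul, mul_pow]
      rw [integral_const_mul, hκn]
      have : ∫ ω, ‖centredLog γ X 0 ω‖ ^ 2 ∂P = 2 * v := by rw [hv, halfVar]; ring
      rw [this]
      field_simp)
    ((iIndepFun_centredLog hindep γ).comp (fun _ z => κ * z) (by fun_prop))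
    (fun i => (identDistrib_centredLog hlaw γ i).comp (u := fun z => κ * z) (by fun_prop))
  set M : ℕ → Ω → ℂ := fun N ω => (N : ℝ)⁻¹ • ∑ j ∈ Finset.range N, centredLog γ X j ω with hM
  have hmM : ∀ N, Measurable (M N) := fun N => by simp only [hM]; fun_prop
  -- The Slutsky factor: linearisation error times the ratio of the true scale to the estimated one.
  set D : ℕ → Ω → ℂ := fun N ω => dslope Complex.exp 0 (M N ω) *
    ((‖γ‖ * Real.sqrt v / (Real.sqrt (logVar k N (fun j => X j ω) / 2) *
      ‖γ * Complex.exp (M N ω)‖) : ℝ) : ℂ) with hD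
  have hmD : ∀ N, Measurable (D N) := fun N => by
    have h1 := measurable_logVar hX k N
    have h2 := hmM N
    have h3 : Measurable (fun ω => dslope Complex.exp 0 (M N ω)) :=
      continuous_dslope_exp.measurable.comp h2
    simp only [hD]
    fun_prop
  have hDlim : ∀ᵐ ω ∂P, Tendsto (fun N => D N ω) atTop (𝓝 1) := by
    filter_upwards [ae_tendsto_logVar hσ hlaw hindep k,
      ae_tendsto_mean_centredLog hσ hlaw hindep] with ω h1 h2
    have h3 := (continuous_dslope_exp.tendsto 0).comp h2
    rw [dslope_exp_zero] at h3
    have h4 := ((Complex.continuous_exp.tendsto 0).comp h2).const_mul γ |>.norm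
    rw [Complex.exp_zero, mul_one] at h4
    have h5 := (Real.continuous_sqrt.tendsto _).comp (h1.div_const 2)
    rw [mul_div_cancel_left₀ _ (two_ne_zero' ℝ)] at h5
    have h6 := (tendsto_const_nhds (x := ‖γ‖ * Real.sqrt v)).div (h5.mul h4)
      (mul_ne_zero hs0.ne' hγn)
    have h7 : ‖γ‖ * Real.sqrt v / (Real.sqrt v * ‖γ‖) = 1 := by field_simp
    rw [h7] at h6
    have h8 := h3.mul ((Complex.continuous_ofReal.tendsto _).comp h6)
    rw [Complex.ofReal_one, one_mul] at h8
    exact h8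
  have hDm : TendstoInMeasure P D atTop (fun _ => 1) :=
    tendstoInMeasure_of_tendsto_ae (fun N => (hmD N).aestronglyMeasurable) hDlim
  have hsl := hclt.continuous_comp_prodMk_of_tendstoInMeasure_const
    (g := fun p : ℂ × ℂ => p.1 * p.2) (by fun_prop) hDm fun N => (hmD N).aemeasurable
  have hlim : (fun z : ℂ => id z * 1) = id := by
    ext z
    all_goals simp
  rw [hlim] at hsl
  have heq : ∀ N ω, (sideScale k N (fun j => X j ω))⁻¹ • (geomMean k N (fun j => X j ω) - γ) =
      ((Real.sqrt N)⁻¹ • ∑ j ∈ Finset.range N, κ * centredLog γ X j ω) * D N ω := by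
    intro N ω
    rcases eq_or_ne N 0 with rfl | hN
    · simp [sideScale]
    have hG : geomMean k N (fun j => X j ω) = γ * Complex.exp (M N ω) :=
      geomMean_eq_exp k hN _ γ hγ0
    have hN0 : 0 < Real.sqrt N := Real.sqrt_pos.2 (Nat.cast_pos.2 (Nat.pos_of_ne_zero hN))
    have hsum : ∑ j ∈ Finset.range N, κ * centredLog γ X j ω = κ * (N * M N ω) := by
      have hNC : (N : ℂ) ≠ 0 := Nat.cast_ne_zero.2 hN
      rw [← Finset.mul_sum, hM]
      simp only [Complex.real_smul]
      push_cast
      field_simp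
    have hNs : (N : ℂ) = ((Real.sqrt N : ℝ) : ℂ) ^ 2 := by
      rw [← Complex.ofReal_pow, Real.sq_sqrt (Nat.cast_nonneg N), Complex.ofReal_natCast]
    have hexp : γ * Complex.exp (M N ω) - γ = γ * (M N ω * dslope Complex.exp 0 (M N ω)) := by
      rw [mul_dslope_exp]; ring
    rw [hsum, hNs, sideScale, hG, hexp, hD, hκ]
    simp only
    rw [Real.sqrt_div' _ two_pos.le, Real.sqrt_mul two_pos.le]
    -- The identity also holds when the estimated scale vanishes, both sides then containing the
    -- inverse of zero.
    generalize ‖γ * Complex.exp (M N ω)‖ = p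
    generalize Real.sqrt (logVar k N fun j => X j ω) = q
    generalize dslope Complex.exp 0 (M N ω) = d
    generalize M N ω = m
    have c1 : ((Real.sqrt N : ℝ) : ℂ) ≠ 0 := Complex.ofReal_ne_zero.2 hN0.ne'
    have c2 : ((Real.sqrt v : ℝ) : ℂ) ≠ 0 := Complex.ofReal_ne_zero.2 hs0.ne'
    have c3 : ((‖γ‖ : ℝ) : ℂ) ≠ 0 := Complex.ofReal_ne_zero.2 hγn
    have c4 : ((Real.sqrt 2 : ℝ) : ℂ) ≠ 0 := Complex.ofReal_ne_zero.2 (by positivity)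
    simp only [Complex.real_smul]
    push_cast
    field_simp
  exact hsl.congr (fun N => ae_of_all _ fun ω => (heq N ω).symm) (ae_eq_refl _)

/-- Where `V_N ≤ 0` the real square root is `0` and the square collapses to its centre, so
membership cannot be rescaled; such events must be discarded. -/
lemma tendsto_measureReal_logVar_nonpos (hσ : 0 < σ) (hX : ∀ j, Measurable (X j))
    (hlaw : ∀ j, HasLaw (X j) (cauchyMeasure μ σ) P) (hindep : iIndepFun X P) (k : ℤ) :
    Tendsto (fun N => P.real {ω | logVar k N (fun j => X j ω) ≤ 0}) atTop (𝓝 0) := by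
  have hv : 0 < 2 * halfVar P ⟨μ, σ⟩ X := mul_pos two_pos (halfVar_pos hσ hlaw)
  have h := tendstoInMeasure_iff_measureReal_dist.1 (tendstoInMeasure_of_tendsto_ae
    (fun N => (measurable_logVar hX k N).aestronglyMeasurable)
    (ae_tendsto_logVar hσ hlaw hindep k)) _ hv
  refine squeeze_zero (fun N => measureReal_nonneg) (fun N => measureReal_mono fun ω hω => ?_) h
  have hω' : logVar k N (fun j => X j ω) ≤ 0 := hω
  change _ ≤ dist _ _
  rw [Real.dist_eq, abs_sub_comm]
  exact le_trans (by linarith) (le_abs_self _)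

lemma sideScale_pos {k : ℤ} {N : ℕ} (hN : N ≠ 0) {x : ℕ → ℝ} (h : 0 < logVar k N x) :
    0 < sideScale k N x := by
  have hN' : 0 < (N : ℝ) := Nat.cast_pos.2 (Nat.pos_of_ne_zero hN)
  have hG : 0 < ‖geomMean k N x‖ :=
    norm_pos_iff.2 (Finset.prod_ne_zero_iff.2 fun j _ => Complex.exp_ne_zero _)
  exact mul_pos (div_pos (Real.sqrt_pos.2 h) (Real.sqrt_pos.2 (by positivity))) hG

end Main
end CauchyGM

/-! ### Limiting coverage probability -/

theorem mainTheorem4 {Ω : Type*} [MeasurableSpace Ω] (P : Measure Ω) [IsProbabilityMeasure P]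
    (μ σ : ℝ) (hσ : 0 < σ)
    (X : ℕ → Ω → ℝ) (hX : ∀ j, Measurable (X j))
    (hlaw : ∀ j, HasLaw (X j) (cauchyMeasure μ ⟨σ, hσ.le⟩) P)
    (hindep : iIndepFun X P)
    (k : ℤ) (α : ℝ) (hα₀ : 0 < α) (hα₁ : α ≤ 1)
    (β : ℝ) (hβ : β = 1 / 2 * (1 - Real.sqrt (1 - α)))
    (ρ : ℝ) (hρ : CauchyGM.IsUpperNormalQuantile β ρ) :
    Tendsto
      (fun N : ℕ =>
        P.real {ω | (⟨μ, σ⟩ : ℂ) ∈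
          CauchyGM.square (CauchyGM.geomMean k N (fun j => X j ω))
            (Real.sqrt (CauchyGM.logVar k N (fun j => X j ω)) / Real.sqrt (2 * (N : ℝ))
              * ‖CauchyGM.geomMean k N (fun j => X j ω)‖ * ρ)})
      atTop (𝓝 (1 - α)) := by
  lift σ to NNReal using hσ.le
  have hσ' : 0 < σ := NNReal.coe_pos.1 hσ
  have hdist := CauchyGM.tendstoInDistribution_studentized hσ' hX hlaw hindep k
  -- Portmanteau theorem: the boundary of the square is a Gaussian null set.
  have hconv := ProbabilityMeasure.tendsto_measure_of_null_frontier_of_tendsto hdist.tendsto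
    (E := Set.Icc (-ρ) ρ ×ℂ Set.Icc (-ρ) ρ) ((ProbabilityMeasure.null_iff_toMeasure_null _ _).2 (by
      change ((stdGaussian ℂ).map id) _ = 0
      rw [Measure.map_id]
      exact CauchyGM.stdGaussian_frontier_reProdIm_Icc ρ))
  have hconv' := (NNReal.continuous_coe.tendsto _).comp hconv
  have hSq : MeasurableSet (Set.Icc (-ρ) ρ ×ℂ Set.Icc (-ρ) ρ) :=
    (Complex.measurable_re measurableSet_Icc).inter (Complex.measurable_im measurableSet_Icc)
  have hval : (stdGaussian ℂ).real (Set.Icc (-ρ) ρ ×ℂ Set.Icc (-ρ) ρ) = 1 - α := by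
    have hβ' : β ≤ 1 / 2 := by rw [hβ]; linarith [Real.sqrt_nonneg (1 - α)]
    rw [CauchyGM.stdGaussian_complex_real_reProdIm measurableSet_Icc measurableSet_Icc,
      CauchyGM.gaussianReal_real_Icc hβ' hρ, hβ]
    -- Here `1 - 2β = √(1 - α)`, one such factor for each coordinate.
    linear_combination Real.mul_self_sqrt (show 0 ≤ 1 - α by linarith)
  refine CauchyGM.tendsto_measureReal_of_agree
    (B := fun N => {ω | (CauchyGM.sideScale k N (fun j => X j ω))⁻¹ •
      (CauchyGM.geomMean k N (fun j => X j ω) - (⟨μ, σ⟩ : ℂ)) ∈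
        Set.Icc (-ρ) ρ ×ℂ Set.Icc (-ρ) ρ}) ?_
    (CauchyGM.tendsto_measureReal_logVar_nonpos hσ' hX hlaw hindep k) ?_
  · rw [← hval]
    convert hconv' using 1
    · ext N
      exact (map_measureReal_apply_of_aemeasurable (hdist.forall_aemeasurable N) hSq).symm
    · congr 1
      change _ = ((stdGaussian ℂ).map id).real _
      rw [Measure.map_id]
  · filter_upwards [eventually_ne_atTop 0] with N hN ω hω
    have hpos : 0 < CauchyGM.logVar k N (fun j => X j ω) := not_le.1 hω
    exact CauchyGM.mem_square_iff (CauchyGM.sideScale_pos hN hpos)
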